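/- Let $d\in\{1,2\}$ and let $E=\{\{x,y\}: x,y\in\mathbb{Z}^d,\ x\neq y\}$ be the edge set of the complete graph on $\mathbb{Z}^d$. Let $(\omega(e))_{e\in E}$ be non-negative real random variables on a common probability space, not assumed to be independent, and suppose that there is a constant $C<\infty$ with $$\mathbb{E}\left[\omega(\{x,y\})\right]\le C\,\|x-y\|^{-2d}\qquad\text{for all } x\neq y \text{ in } \mathbb{Z}^d,$$ where $\|\cdot\|$ is the Euclidean norm. Then for almost every realization of $\omega$, every vertex $y$ has finite total weight $\sum_{e\ni y}\omega(e)<\infty$, and the random walk on the weights $\omega$ is recurrent. Here the random walk on the weights is the Markov chain $(Y_n)_{n\ge 0}$ on $\mathbb{Z}^d$ with $$\mathbb{P}(Y_{n+1}=x\mid Y_n=y)=\frac{\omega(\{x,y\})}{\sum_{e\ni y}\omega(e)}\qquad (x\neq y)$$ if $\sum_{e\ni y}\omega(e)>0$, and it stays at $y$ forever if $\sum_{e\ni y}\omega(e)=0$. It is called recurrent if for every starting point $a\in\mathbb{Z}^d$ the walk started at $a$ almost surely visits $a$ infinitely often. -/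

import Mathlib

open MeasureTheory ProbabilityTheory
open scoped ENNReal NNReal

noncomputable section

namespace WeightedWalk

variable {V : Type*}

/-- The conductance between `x` and `y` in a graph `G` whose edges carry the non-negative
weights `w`: the weight of the edge `{x, y}`, and `0` if `x` and `y` are not adjacent. -/
def conductance (G : SimpleGraph V) (w : G.edgeSet → ℝ≥0) (x y : V) : ℝ≥0∞ :=
  open Classical in if h : G.Adj x y then (w ⟨s(x, y), h⟩ : ℝ≥0∞) else 0

/-- The total weight of the edges with endpoint `x`. -/
def totalConductance (G : SimpleGraph V) (w : G.edgeSet → ℝ≥0) (x : V) : ℝ≥0∞ :=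
  ∑' y, conductance G w x y

/-- The law of one step of the random walk on the weights `w`, started from `x`: the walk jumps
to `y` with probability `w {x, y} / ∑_{e ∋ x} w e`, and stays at `x` if all edges at `x` have
weight `0`. (The walk is only meaningful if every total weight is finite; by convention it also
stays at a vertex whose total weight is infinite.) -/
def step (G : SimpleGraph V) (w : G.edgeSet → ℝ≥0) (x : V) : PMF V :=
  open Classical in
  if h : totalConductance G w x ≠ 0 ∧ totalConductance G w x ≠ ∞ then
    PMF.normalize (conductance G w x) h.1 h.2
  else PMF.pure x

variable [Countable V] [MeasurableSpace V] [MeasurableSingletonClass V]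

/-- The transition kernel of the random walk on the weights `w`. -/
def stepKernel (G : SimpleGraph V) (w : G.edgeSet → ℝ≥0) : Kernel V V :=
  Kernel.ofFunOfCountable fun x => (step G w x).toMeasure

instance (G : SimpleGraph V) (w : G.edgeSet → ℝ≥0) : IsMarkovKernel (stepKernel G w) :=
  ⟨fun x => inferInstanceAs (IsProbabilityMeasure (step G w x).toMeasure)⟩

/-- The transition kernel seen as a function of the trajectory up to time `n`: the next step
depends on the trajectory only through its position at time `n`. -/
def historyKernel (G : SimpleGraph V) (w : G.edgeSet → ℝ≥0) (n : ℕ) :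
    Kernel (Π _ : Finset.Iic n, V) V :=
  (stepKernel G w).comap (fun path => path ⟨n, Finset.mem_Iic.2 le_rfl⟩) (measurable_pi_apply _)

instance (G : SimpleGraph V) (w : G.edgeSet → ℝ≥0) (n : ℕ) :
    IsMarkovKernel (historyKernel G w n) := by
  unfold historyKernel; infer_instance

/-- The law, on the space of trajectories, of the random walk on the weights `w` started at `a`. -/
def walkLaw (G : SimpleGraph V) (w : G.edgeSet → ℝ≥0) (a : V) : Measure (ℕ → V) :=
  Kernel.trajMeasure (X := fun _ => V) (Measure.dirac a) (historyKernel G w)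

/-- The random walk on the weights `w` is recurrent: for every starting point `a`, the walk
started at `a` almost surely visits `a` infinitely often. -/
def IsRecurrent (G : SimpleGraph V) (w : G.edgeSet → ℝ≥0) : Prop :=
  ∀ a : V, ∀ᵐ X ∂(walkLaw G w a), ∃ᶠ n in Filter.atTop, X n = a

end WeightedWalk

/-- The Euclidean norm of a point of `ℤ^d`. -/
def latticeNorm {d : ℕ} (x : Fin d → ℤ) : ℝ :=
  ‖(WithLp.toLp 2 (fun i => (x i : ℝ)) : EuclideanSpace ℝ (Fin d))‖

end

/-!
The proof rests on a variational criterion: for deterministic weights with finite totals, the walk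
is recurrent at `a` as soon as there are finitely supported functions `f` with `f a = 1` and
arbitrarily small Dirichlet energy `∑ w {x, y} (f x - f y)²`. The energy is linear in the weights,
so its expectation is at most `C` times the energy of `f` for the deterministic kernel
`‖x - y‖^(-2d)`, and independence plays no role. If the latter energies tend to zero along a
sequence of test functions, Fatou's lemma (`ae_exists_energy_le`) gives, for almost every
realization, test functions with arbitrarily small energy.

*The criterion* (`WeightedWalk.frequently_eq_of_energy_le`). Let `v x` be the probability that the
walk started at `x` ever visits `a`. It is superharmonic, and harmonic off `a`. Barta's inequality
`WeightedWalk.barta_le_energy`, applied to the positive superharmonic function `1 + v`, bounds the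
defect of harmonicity of `v` at `a` by the energy of `f`. So the defect vanishes, `v` is harmonic
everywhere, and `E v(X_N) = v a = 1` for all `N`. Since the walk visits `a` after time `N` with
probability at least `E v(X_N)`, it almost surely does so for every `N`
(`WeightedWalk.frequently_eq_of_lintegral_hitProb_eq_one`). This uses the Markov property at
deterministic times only.

*The test functions* (`energy_criticalKernel_cutoff_le`). The kernel `‖x - y‖^(-2d)` is critical in
dimension two: cutting off linearly in `log ‖x‖` leaves an energy of order one. The function
`cutoff R` is therefore linear in `g = log log ‖x‖`, between the origin and distance `R`. At a
point of norm `n` the increments of `g` are those of a logarithm at scale `n`, divided by `log n`;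
the kernel integrates the square of the former to at most a constant times `n^(-d) log n`
(`tsum_kernel_mul_log_sq_le`). Summing `n^(-d) / log n` over the points of norm at most `R` gives
`∑ 1 / (n log n)`, of order `g R`, and normalization divides by `g R ^ 2`. Hence the energy is of
order `1 / g R`.
-/

noncomputable section

namespace WeightedWalk

/-! ### Hitting probabilities and recurrence -/

section Walk

lemma measurableSet_exists_ge_eq {V : Type*} [MeasurableSpace V] [MeasurableSingletonClass V]
    (a : V) (N : ℕ) : MeasurableSet {X : ℕ → V | ∃ n ≥ N, X n = a} := by
  have : {X : ℕ → V | ∃ n ≥ N, X n = a} = ⋃ n ≥ N, (fun X : ℕ → V => X n) ⁻¹' {a} := by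
    ext; simp
  rw [this]
  exact MeasurableSet.iUnion fun n => MeasurableSet.iUnion fun _ =>
    measurable_pi_apply n (measurableSet_singleton a)

variable {V : Type*} [Countable V] [MeasurableSpace V] [MeasurableSingletonClass V]

open Classical in
/-- The probability that the walk started at `x` visits `a` at one of the times `0, …, m`. -/
def hitWithin (G : SimpleGraph V) (w : G.edgeSet → ℝ≥0) (a : V) : ℕ → V → ℝ≥0∞
  | 0, x => if x = a then 1 else 0
  | m + 1, x => if x = a then 1 else ∫⁻ y, hitWithin G w a m y ∂stepKernel G w x

/-- The probability that the walk started at `x` ever visits `a`. -/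
def hitProb (G : SimpleGraph V) (w : G.edgeSet → ℝ≥0) (a x : V) : ℝ≥0∞ :=
  ⨆ m, hitWithin G w a m x

variable (G : SimpleGraph V) (w : G.edgeSet → ℝ≥0) (a : V)

lemma hitWithin_self (m : ℕ) : hitWithin G w a m a = 1 := by
  cases m <;> simp [hitWithin]

lemma hitWithin_le_one (m : ℕ) (x : V) : hitWithin G w a m x ≤ 1 := by
  induction m generalizing x with
  | zero => unfold hitWithin; split_ifs <;> simp
  | succ m ih =>
    unfold hitWithin
    split_ifs
    · exact le_rfl
    · calc ∫⁻ y, hitWithin G w a m y ∂stepKernel G w x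
          ≤ ∫⁻ _, 1 ∂stepKernel G w x := lintegral_mono ih
        _ = 1 := by simp

lemma hitWithin_le_succ (m : ℕ) (x : V) : hitWithin G w a m x ≤ hitWithin G w a (m + 1) x := by
  induction m generalizing x with
  | zero => by_cases h : x = a <;> simp [hitWithin, h]
  | succ m ih =>
    by_cases h : x = a
    · simp [hitWithin, h]
    · rw [hitWithin, hitWithin, if_neg h, if_neg h]
      exact lintegral_mono ih

lemma monotone_hitWithin : Monotone (hitWithin G w a) :=
  monotone_nat_of_le_succ fun m x => hitWithin_le_succ G w a m x

lemma hitProb_self : hitProb G w a a = 1 := by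
  simp [hitProb, hitWithin_self]

lemma hitProb_le_one (x : V) : hitProb G w a x ≤ 1 :=
  iSup_le fun m => hitWithin_le_one G w a m x

lemma lintegral_hitProb_eq_iSup (μ : Measure V) :
    ∫⁻ y, hitProb G w a y ∂μ = ⨆ m, ∫⁻ y, hitWithin G w a m y ∂μ :=
  lintegral_iSup (fun _ => measurable_of_countable _) (monotone_hitWithin G w a)

lemma lintegral_hitProb_le_one (x : V) : ∫⁻ y, hitProb G w a y ∂stepKernel G w x ≤ 1 :=
  (lintegral_mono (hitProb_le_one G w a)).trans (by simp)

/-- Away from its target, the hitting probability is harmonic. -/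
lemma lintegral_hitProb_of_ne {x : V} (hx : x ≠ a) :
    ∫⁻ y, hitProb G w a y ∂stepKernel G w x = hitProb G w a x := by
  rw [lintegral_hitProb_eq_iSup, hitProb]
  apply le_antisymm
  · refine iSup_le fun m => le_iSup_of_le (m + 1) ?_
    rw [hitWithin, if_neg hx]
  · refine iSup_le fun m => le_iSup_of_le m ?_
    refine (hitWithin_le_succ G w a m x).trans ?_
    rw [hitWithin, if_neg hx]

instance : IsProbabilityMeasure (walkLaw G w a) := by
  unfold walkLaw; infer_instance

/-- The Markov property at a deterministic time. -/
lemma lintegral_walkLaw_succ (n : ℕ) {g : (Π _ : Finset.Iic n, V) → ℝ≥0∞} (hg : Measurable g)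
    (φ : V → ℝ≥0∞) :
    ∫⁻ X, g (Preorder.frestrictLe n X) * φ (X (n + 1)) ∂walkLaw G w a =
      ∫⁻ X, g (Preorder.frestrictLe n X) * ∫⁻ y, φ y ∂stepKernel G w (X n) ∂walkLaw G w a := by
  have hφ : Measurable φ := measurable_of_countable φ
  have key := Kernel.map_frestrictLe_trajMeasure_compProd_eq_map_trajMeasure
    (X := fun _ => V) (μ₀ := Measure.dirac a) (κ := historyKernel G w) (a := n)
  have hF : Measurable fun p : (Π _ : Finset.Iic n, V) × V => g p.1 * φ p.2 := by fun_prop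
  calc ∫⁻ X, g (Preorder.frestrictLe n X) * φ (X (n + 1)) ∂walkLaw G w a
      = ∫⁻ p, g p.1 * φ p.2 ∂((walkLaw G w a).map
          fun X => (Preorder.frestrictLe n X, X (n + 1))) := by
        rw [lintegral_map hF (by fun_prop)]
    _ = ∫⁻ p, g p.1 * φ p.2
          ∂((walkLaw G w a).map (Preorder.frestrictLe n) ⊗ₘ historyKernel G w n) := by
        rw [walkLaw, key]
    _ = _ := by
        rw [Measure.lintegral_compProd hF,
          lintegral_map hF.lintegral_kernel_prod_right' (by fun_prop)]
        refine lintegral_congr fun X => ?_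
        change ∫⁻ y, g (Preorder.frestrictLe n X) * φ y ∂stepKernel G w (X n) = _
        exact lintegral_const_mul _ hφ

lemma walkLaw_map_zero : (walkLaw G w a).map (fun X => X 0) = Measure.dirac a := by
  have h : (fun X : ℕ → V => X 0) =
      (fun p : Π _ : Finset.Iic 0, V => p ⟨0, Finset.mem_Iic.2 le_rfl⟩) ∘
        Preorder.frestrictLe (π := fun _ => V) 0 := rfl
  rw [h, ← Measure.map_map (by fun_prop) (by fun_prop), walkLaw, Kernel.trajMeasure,
    Measure.map_comp _ _ (by fun_prop), Kernel.traj_map_frestrictLe, Kernel.partialTraj_self,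
    Measure.id_comp, Measure.map_map (by fun_prop) (by fun_prop)]
  exact Measure.map_dirac' (Measurable.comp (by fun_prop) (MeasurableEquiv.measurable _)) a

/-- The conditional probability of visiting `a` at some time `n ≥ N`, given the path up to time `N`,
is at least `hitWithin a m (X N)`. The arbitrary event `S` in the past is what lets the induction
on `m` go through. -/
lemma setLIntegral_hitWithin_le (m N : ℕ) {S : Set (Π _ : Finset.Iic N, V)}
    (hS : MeasurableSet S) :
    ∫⁻ X in Preorder.frestrictLe (π := fun _ => V) N ⁻¹' S, hitWithin G w a m (X N)
        ∂walkLaw G w a ≤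
      walkLaw G w a (Preorder.frestrictLe (π := fun _ => V) N ⁻¹' S ∩ {X | ∃ n ≥ N, X n = a}) := by
  induction m generalizing N with
  | zero =>
    have hE : MeasurableSet {X : ℕ → V | X N = a} :=
      (measurable_pi_apply N : Measurable fun X : ℕ → V => X N) (measurableSet_singleton a)
    have h : ∀ X : ℕ → V, hitWithin G w a 0 (X N) = {X : ℕ → V | X N = a}.indicator 1 X := by
      intro X
      by_cases hX : X N = a <;> simp [hitWithin, hX]
    simp_rw [h]
    rw [lintegral_indicator_one hE, Measure.restrict_apply hE, Set.inter_comm]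
    exact measure_mono (Set.inter_subset_inter_right _ fun X hX => ⟨N, le_rfl, hX⟩)
  | succ m ih =>
    set T : Set (ℕ → V) := Preorder.frestrictLe (π := fun _ => V) N ⁻¹' S
    have hT : MeasurableSet T := (Preorder.measurable_frestrictLe N) hS
    set E : Set (ℕ → V) := {X : ℕ → V | X N = a}
    have hE : MeasurableSet E :=
      (measurable_pi_apply N : Measurable fun X : ℕ → V => X N) (measurableSet_singleton a)
    -- The part of `S` where the path is not at `a` at time `N`.
    set S' : Set (Π _ : Finset.Iic N, V) :=
      S ∩ {p | p ⟨N, Finset.mem_Iic.2 le_rfl⟩ ≠ a}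
    have hS' : MeasurableSet S' :=
      hS.inter (measurable_pi_apply (X := fun _ : Finset.Iic N => V) _
        (measurableSet_singleton a)).compl
    have hTE' : Preorder.frestrictLe (π := fun _ => V) (N + 1) ⁻¹'
        (Preorder.frestrictLe₂ (π := fun _ => V) N.le_succ ⁻¹' S') = T \ E := rfl
    rw [← lintegral_inter_add_sdiff _ T hE]
    have h1 : ∫⁻ X in T ∩ E, hitWithin G w a (m + 1) (X N) ∂walkLaw G w a =
        walkLaw G w a (T ∩ E) := by
      rw [setLIntegral_congr_fun (g := fun _ => 1) (hT.inter hE), setLIntegral_one]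
      intro X hX
      have : X N = a := hX.2
      simp only [this, hitWithin_self]
    have h2 : ∫⁻ X in T \ E, hitWithin G w a (m + 1) (X N) ∂walkLaw G w a =
        ∫⁻ X in T \ E, hitWithin G w a m (X (N + 1)) ∂walkLaw G w a := by
      have key := lintegral_walkLaw_succ G w a N
        (g := S'.indicator 1) (measurable_one.indicator hS') (hitWithin G w a m)
      rw [← lintegral_indicator (hT.diff hE), ← lintegral_indicator (hT.diff hE)]
      refine Eq.trans (lintegral_congr fun X => ?_) (key.symm.trans (lintegral_congr fun X => ?_))
      · by_cases hX : X ∈ T \ E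
        · have hX' : Preorder.frestrictLe N X ∈ S' := hX
          rw [Set.indicator_of_mem hX, Set.indicator_of_mem hX', Pi.one_apply, one_mul,
            hitWithin, if_neg (show X N ≠ a from hX.2)]
        · have hX' : Preorder.frestrictLe N X ∉ S' := hX
          rw [Set.indicator_of_notMem hX, Set.indicator_of_notMem hX', zero_mul]
      · by_cases hX : X ∈ T \ E
        · have hX' : Preorder.frestrictLe N X ∈ S' := hX
          rw [Set.indicator_of_mem hX, Set.indicator_of_mem hX', Pi.one_apply, one_mul]
        · have hX' : Preorder.frestrictLe N X ∉ S' := hX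
          rw [Set.indicator_of_notMem hX, Set.indicator_of_notMem hX', zero_mul]
    have h3 := ih (N + 1) (S := Preorder.frestrictLe₂ (π := fun _ => V) N.le_succ ⁻¹' S')
      ((Preorder.measurable_frestrictLe₂ N.le_succ) hS')
    rw [hTE'] at h3
    rw [h1, h2]
    refine (add_le_add_right h3 _).trans ?_
    rw [← measure_union _ ((hT.diff hE).inter (measurableSet_exists_ge_eq a (N + 1)))]
    · refine measure_mono (Set.union_subset ?_ ?_)
      · exact fun X hX => ⟨hX.1, N, le_rfl, hX.2⟩
      · rintro X ⟨hX, n, hn, hXn⟩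
        exact ⟨hX.1, n, (Nat.le_succ N).trans hn, hXn⟩
    · exact Set.disjoint_left.2 fun X hX hX' => hX'.1.2 hX.2

/-- A walk that returns to `a` with probability one visits `a` infinitely often: the probability
of hitting `a` is then harmonic everywhere, so the probability of visiting `a` after time `N` is
the same for all `N`. -/
lemma frequently_eq_of_lintegral_hitProb_eq_one
    (h : ∫⁻ y, hitProb G w a y ∂stepKernel G w a = 1) :
    ∀ᵐ X ∂walkLaw G w a, ∃ᶠ n in Filter.atTop, X n = a := by
  have harm : ∀ x, ∫⁻ y, hitProb G w a y ∂stepKernel G w x = hitProb G w a x := by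
    intro x
    by_cases hx : x = a
    · rw [hx, h, hitProb_self]
    · exact lintegral_hitProb_of_ne G w a hx
  -- Hence the expectation of `hitProb` along the walk stays equal to its initial value.
  have hone : ∀ N, ∫⁻ X, hitProb G w a (X N) ∂walkLaw G w a = 1 := by
    intro N
    induction N with
    | zero =>
      rw [← lintegral_map (f := hitProb G w a) (g := fun X : ℕ → V => X 0)
        (measurable_of_countable _) (by fun_prop), walkLaw_map_zero,
        lintegral_dirac' _ (measurable_of_countable _), hitProb_self]
    | succ N ih =>
      have key := lintegral_walkLaw_succ G w a N (g := 1) measurable_one (hitProb G w a)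
      simp only [Pi.one_apply, one_mul, harm] at key
      rw [key, ih]
  have hvisit : ∀ N, ∀ᵐ X ∂walkLaw G w a, ∃ n ≥ N, X n = a := by
    intro N
    refine (prob_compl_eq_zero_iff (measurableSet_exists_ge_eq a N)).2
      (le_antisymm prob_le_one ?_)
    calc (1 : ℝ≥0∞) = ∫⁻ X, hitProb G w a (X N) ∂walkLaw G w a := (hone N).symm
      _ = ∫⁻ X, ⨆ m, hitWithin G w a m (X N) ∂walkLaw G w a := rfl
      _ = ⨆ m, ∫⁻ X, hitWithin G w a m (X N) ∂walkLaw G w a := by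
        refine lintegral_iSup (fun m => ?_) fun m m' hm X => monotone_hitWithin G w a hm (X N)
        exact (measurable_of_countable (hitWithin G w a m)).comp (measurable_pi_apply N)
      _ ≤ walkLaw G w a {X | ∃ n ≥ N, X n = a} := by
        refine iSup_le fun m => ?_
        simpa using setLIntegral_hitWithin_le G w a m N MeasurableSet.univ
  filter_upwards [ae_all_iff.2 hvisit] with X hX
  exact Filter.frequently_atTop.2 hX

end Walk

/-! ### Dirichlet energy and Barta's inequality -/

section Energy

variable {V : Type*}

lemma conductance_comm (G : SimpleGraph V) (w : G.edgeSet → ℝ≥0) (x y : V) :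
    conductance G w x y = conductance G w y x := by
  unfold conductance
  by_cases h : G.Adj x y
  · rw [dif_pos h, dif_pos h.symm]
    congr 3
    exact Sym2.eq_swap
  · rw [dif_neg h, dif_neg fun h' => h h'.symm]

/-- Twice the Dirichlet energy of `f` for the symmetric weights `c`: the sum runs over ordered
pairs, so that every edge is counted twice. -/
def energy (c : V → V → ℝ≥0∞) (f : V → ℝ) : ℝ≥0∞ :=
  ∑' x, ∑' y, c x y * ENNReal.ofReal ((f x - f y) ^ 2)

/-- The contribution of a single edge to Barta's inequality, where `p` and `q` are the values of the
superharmonic function at the endpoints. -/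
lemma sq_add_sq_le_barta (s t p q : ℝ) (hp : 0 < p) (hq : 0 < q) :
    ENNReal.ofReal (s ^ 2) + ENNReal.ofReal (t ^ 2) ≤ ENNReal.ofReal ((s - t) ^ 2) +
      (ENNReal.ofReal (s ^ 2) * ENNReal.ofReal (q / p) +
        ENNReal.ofReal (t ^ 2) * ENNReal.ofReal (p / q)) := by
  rw [← ENNReal.ofReal_mul (by positivity), ← ENNReal.ofReal_mul (by positivity),
    ← ENNReal.ofReal_add (by positivity) (by positivity),
    ← ENNReal.ofReal_add (by positivity) (by positivity),
    ← ENNReal.ofReal_add (by positivity) (by positivity)]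
  apply ENNReal.ofReal_le_ofReal
  have : s ^ 2 * (q / p) + t ^ 2 * (p / q) - 2 * s * t = (s * q - t * p) ^ 2 / (p * q) := by
    field_simp; ring
  have : 0 ≤ (s * q - t * p) ^ 2 / (p * q) := by positivity
  nlinarith

/-- Barta's inequality: a positive function `u` that is superharmonic off `a` bounds the energy
of `f` below in terms of its defect of harmonicity at `a`. -/
lemma barta_le_energy {c : V → V → ℝ≥0∞} (hc : ∀ x y, c x y = c y x)
    (hfin : ∀ x, ∑' y, c x y ≠ ∞) {f : V → ℝ} (hf : f.support.Finite) {u : V → ℝ}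
    (hu : ∀ x, 0 < u x) (a : V)
    (hsup : ∀ x, x ≠ a → ∑' y, c x y * ENNReal.ofReal (u y / u x) ≤ ∑' y, c x y) :
    2 * (ENNReal.ofReal (f a ^ 2) * ∑' y, c a y) ≤ energy c f +
      2 * (ENNReal.ofReal (f a ^ 2) * ∑' y, c a y * ENNReal.ofReal (u y / u a)) := by
  classical
  set q : V → ℝ≥0∞ := fun x => ENNReal.ofReal (f x ^ 2) with hq
  set A : V → ℝ≥0∞ := fun x => q x * ∑' y, c x y with hA
  set B : V → ℝ≥0∞ := fun x => q x * ∑' y, c x y * ENNReal.ofReal (u y / u x) with hB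
  have main : 2 * ∑' x, A x ≤ energy c f + 2 * ∑' x, B x := by
    have h1 : ∑' x, ∑' y, c x y * (q x + q y) = 2 * ∑' x, A x := by
      simp_rw [mul_add, ENNReal.tsum_add]
      rw [two_mul]
      congr 1
      · refine tsum_congr fun x => ?_
        rw [ENNReal.tsum_mul_right, mul_comm]
      · rw [ENNReal.tsum_comm]
        refine tsum_congr fun x => ?_
        rw [ENNReal.tsum_mul_right, mul_comm]
        simp_rw [hA, hc x]
    have h2 : ∑' x, ∑' y, c x y * (q x * ENNReal.ofReal (u y / u x) +
        q y * ENNReal.ofReal (u x / u y)) = 2 * ∑' x, B x := by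
      simp_rw [mul_add, ENNReal.tsum_add]
      rw [two_mul]
      congr 1
      · refine tsum_congr fun x => ?_
        simp_rw [hB, ← ENNReal.tsum_mul_left]
        exact tsum_congr fun y => by ring
      · rw [ENNReal.tsum_comm]
        refine tsum_congr fun x => ?_
        simp_rw [hB, ← ENNReal.tsum_mul_left]
        exact tsum_congr fun y => by rw [hc]; ring
    rw [← h1, ← h2, energy, ← ENNReal.tsum_add]
    refine ENNReal.tsum_le_tsum fun x => ?_
    rw [← ENNReal.tsum_add]
    refine ENNReal.tsum_le_tsum fun y => ?_
    rw [← mul_add]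
    exact mul_le_mul_right (sq_add_sq_le_barta _ _ _ _ (hu x) (hu y)) _
  -- The terms with `x ≠ a` cancel, because they have a finite sum.
  rw [ENNReal.tsum_eq_add_tsum_ite a, ENNReal.tsum_eq_add_tsum_ite (f := B) a] at main
  have hle : ∑' x, (if x = a then 0 else B x) ≤ ∑' x, (if x = a then 0 else A x) := by
    refine ENNReal.tsum_le_tsum fun x => ?_
    split_ifs with h
    · exact le_rfl
    · exact mul_le_mul_right (hsup x h) _
  have hne : ∑' x, (if x = a then 0 else A x) ≠ ∞ := by
    rw [tsum_eq_sum (s := hf.toFinset)]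
    · refine ENNReal.sum_ne_top.2 fun x _ => ?_
      split_ifs
      · simp
      · exact ENNReal.mul_ne_top ENNReal.ofReal_ne_top (hfin x)
    · intro x hx
      have : f x = 0 := by simpa using hx
      simp [hA, hq, this]
  rw [mul_add, mul_add, ← add_assoc] at main
  refine (ENNReal.add_le_add_iff_right (ENNReal.mul_ne_top ENNReal.ofNat_ne_top hne)).1
    (main.trans ?_)
  gcongr

end Energy

/-! ### The energy criterion for recurrence -/

section Criterion

variable {V : Type*} [Countable V] [MeasurableSpace V] [MeasurableSingletonClass V]
  (G : SimpleGraph V) (w : G.edgeSet → ℝ≥0)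

lemma lintegral_stepKernel {x : V} (h0 : totalConductance G w x ≠ 0)
    (h : totalConductance G w x ≠ ∞) (φ : V → ℝ≥0∞) :
    totalConductance G w x * ∫⁻ y, φ y ∂stepKernel G w x = ∑' y, conductance G w x y * φ y := by
  have hk : stepKernel G w x = (step G w x).toMeasure := rfl
  rw [lintegral_countable' φ, ← ENNReal.tsum_mul_left]
  refine tsum_congr fun y => ?_
  have hs : step G w x y = conductance G w x y * (totalConductance G w x)⁻¹ := by
    rw [step, dif_pos ⟨h0, h⟩]
    rfl
  rw [hk, PMF.toMeasure_apply_singleton _ _ (measurableSet_singleton y), hs]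
  calc totalConductance G w x * (φ y * (conductance G w x y * (totalConductance G w x)⁻¹))
      = (totalConductance G w x * (totalConductance G w x)⁻¹) * (conductance G w x y * φ y) := by
        ring
    _ = _ := by rw [ENNReal.mul_inv_cancel h0 h, one_mul]

/-- The walk is recurrent at `a` if there are finitely supported functions that equal `1` at `a`
and have arbitrarily small energy. Barta's inequality is applied to `1 + hitProb`: adding `1` keeps
the function positive at the vertices from which `a` cannot be reached. -/
lemma frequently_eq_of_energy_le (hfin : ∀ x, totalConductance G w x ≠ ∞) (a : V)
    (h : ∀ ε : ℝ≥0∞, 0 < ε → ∃ f : V → ℝ, f.support.Finite ∧ f a = 1 ∧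
      energy (conductance G w) f ≤ ε) :
    ∀ᵐ X ∂walkLaw G w a, ∃ᶠ n in Filter.atTop, X n = a := by
  classical
  apply frequently_eq_of_lintegral_hitProb_eq_one
  by_cases h0 : totalConductance G w a = 0
  · have hk : stepKernel G w a = Measure.dirac a := by
      change (step G w a).toMeasure = _
      rw [step, dif_neg (by simp [h0]), PMF.toMeasure_pure]
    rw [hk, lintegral_dirac' _ (measurable_of_countable _), hitProb_self]
  set v := hitProb G w a
  set u : V → ℝ := fun x => 1 + (v x).toReal with hu
  have hvtop : ∀ x, v x ≠ ∞ := fun x => ne_top_of_le_ne_top ENNReal.one_ne_top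
    (hitProb_le_one G w a x)
  have hupos : ∀ x, 0 < u x := fun x => by positivity
  have hofu : ∀ x, ENNReal.ofReal (u x) = 1 + v x := fun x => by
    rw [hu, ENNReal.ofReal_add zero_le_one ENNReal.toReal_nonneg, ENNReal.ofReal_one,
      ENNReal.ofReal_toReal (hvtop x)]
  have hsum : ∀ x, ∑' y, conductance G w x y * ENNReal.ofReal (u y / u x) =
      (∑' y, conductance G w x y * (1 + v y)) / (1 + v x) := by
    intro x
    rw [div_eq_mul_inv, ← ENNReal.tsum_mul_right]
    refine tsum_congr fun y => ?_
    rw [ENNReal.ofReal_div_of_pos (hupos x), hofu, hofu, div_eq_mul_inv, mul_assoc]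
  have hstep : ∀ x, totalConductance G w x ≠ 0 → ∑' y, conductance G w x y * (1 + v y) =
      totalConductance G w x * (1 + ∫⁻ y, v y ∂stepKernel G w x) := by
    intro x hx
    rw [← lintegral_stepKernel G w hx (hfin x), lintegral_add_left measurable_const]
    simp
  have hsup : ∀ x, x ≠ a → ∑' y, conductance G w x y * ENNReal.ofReal (u y / u x) ≤
      ∑' y, conductance G w x y := by
    intro x hx
    by_cases hx0 : totalConductance G w x = 0
    · have : ∀ y, conductance G w x y = 0 := ENNReal.tsum_eq_zero.1 hx0
      simp [this]
    · rw [hsum, hstep x hx0, lintegral_hitProb_of_ne G w a hx]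
      refine ENNReal.div_le_of_le_mul ?_
      rfl
  set r := ∫⁻ y, v y ∂stepKernel G w a with hr
  have hr1 : r ≤ 1 := lintegral_hitProb_le_one G w a a
  have key : 2 * totalConductance G w a ≤ totalConductance G w a * (1 + r) := by
    refine ENNReal.le_of_forall_pos_le_add fun ε hε _ => ?_
    obtain ⟨f, hf, hfa, hfε⟩ := h ε (by exact_mod_cast hε)
    have := barta_le_energy (conductance_comm G w) hfin hf hupos a hsup
    have hva : v a = 1 := hitProb_self G w a
    rw [hfa, hsum, hstep a h0, ← hr, hva, one_pow, ENNReal.ofReal_one, one_mul, one_mul,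
      one_add_one_eq_two, ENNReal.mul_div_cancel two_ne_zero ENNReal.ofNat_ne_top] at this
    refine this.trans ?_
    rw [add_comm]
    gcongr
  rw [mul_comm, ENNReal.mul_le_mul_iff_right h0 (hfin a), ← one_add_one_eq_two] at key
  exact le_antisymm hr1 ((ENNReal.add_le_add_iff_left ENNReal.one_ne_top).1 key)

end Criterion

end WeightedWalk

/-! ### Radial sums over the lattice -/

section Shells

/-- The supremum norm of a lattice point, as a natural number. -/
def supNorm {d : ℕ} (x : Fin d → ℤ) : ℕ :=
  Finset.univ.sup fun i => (x i).natAbs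

lemma supNorm_add_le {d : ℕ} (x y : Fin d → ℤ) : supNorm (x + y) ≤ supNorm x + supNorm y := by
  refine Finset.sup_le fun i _ => (Int.natAbs_add_le _ _).trans (add_le_add ?_ ?_)
  · exact Finset.le_sup (f := fun i => (x i).natAbs) (Finset.mem_univ i)
  · exact Finset.le_sup (f := fun i => (y i).natAbs) (Finset.mem_univ i)

lemma supNorm_neg {d : ℕ} (x : Fin d → ℤ) : supNorm (-x) = supNorm x := by
  simp [supNorm]

@[simp] lemma supNorm_zero {d : ℕ} : supNorm (0 : Fin d → ℤ) = 0 := by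
  simp [supNorm]

lemma supNorm_eq_zero {d : ℕ} {x : Fin d → ℤ} : supNorm x = 0 ↔ x = 0 := by
  simp [supNorm, funext_iff]

lemma supNorm_le_latticeNorm {d : ℕ} (x : Fin d → ℤ) : (supNorm x : ℝ) ≤ latticeNorm x := by
  have hle : supNorm x ≤ ⌊latticeNorm x⌋₊ := by
    refine Finset.sup_le fun i _ => Nat.le_floor ?_
    rw [latticeNorm, Nat.cast_natAbs, Int.cast_abs]
    exact PiLp.norm_apply_le (WithLp.toLp 2 (fun i => (x i : ℝ)) : EuclideanSpace ℝ (Fin d)) i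
  exact (Nat.cast_le.2 hle).trans (Nat.floor_le (norm_nonneg _))

/-- A finite set containing the sphere of radius `r` in the supremum norm: some coordinate is `±r`,
and the others lie in `[-r, r]`. -/
def shellCover (d r : ℕ) : Finset (Fin d → ℤ) :=
  Finset.univ.biUnion fun i => Fintype.piFinset fun j =>
    if j = i then {(r : ℤ), -(r : ℤ)} else Finset.Icc (-(r : ℤ)) r

lemma mem_shellCover {d r : ℕ} [NeZero d] {x : Fin d → ℤ} (hx : supNorm x = r) :
    x ∈ shellCover d r := by
  have hle : ∀ j, (x j).natAbs ≤ r := fun j =>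
    hx ▸ Finset.le_sup (f := fun i => (x i).natAbs) (Finset.mem_univ j)
  obtain ⟨i, -, hi⟩ := Finset.exists_mem_eq_sup Finset.univ Finset.univ_nonempty
    fun i => (x i).natAbs
  have hi' : (x i).natAbs = r := by rw [← hx, supNorm, hi]
  refine Finset.mem_biUnion.2 ⟨i, Finset.mem_univ i, Fintype.mem_piFinset.2 fun j => ?_⟩
  have := hle j
  split_ifs with h
  · subst h
    simp only [Finset.mem_insert, Finset.mem_singleton]
    omega
  · rw [Finset.mem_Icc]
    omega

lemma card_shellCover_le {d : ℕ} (hd : d = 1 ∨ d = 2) (r : ℕ) :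
    (shellCover d r).card ≤ 8 * (r + 1) ^ (d - 1) := by
  have h2 : ({(r : ℤ), -(r : ℤ)} : Finset ℤ).card ≤ 2 := Finset.card_le_two
  refine Finset.card_biUnion_le.trans ?_
  rcases hd with rfl | rfl
  · simp only [Fintype.card_piFinset, Fin.sum_univ_one, Fin.prod_univ_one, if_true,
      Nat.sub_self, pow_zero]
    omega
  · simp only [Fintype.card_piFinset, Fin.sum_univ_two, Fin.prod_univ_two, if_true]
    simp only [Fin.isValue, one_ne_zero, zero_ne_one, if_false, Int.card_Icc]
    have : ((r : ℤ) + 1 - -(r : ℤ)).toNat = 2 * r + 1 := by omega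
    rw [this]
    norm_num
    nlinarith

/-- Summation in shells: a sum of a radial function over `ℤ^d` is controlled by a sum over radii. -/
lemma tsum_comp_supNorm_le {d : ℕ} (hd : d = 1 ∨ d = 2) (h : ℕ → ℝ≥0∞) :
    ∑' x : Fin d → ℤ, h (supNorm x) ≤ ∑' r : ℕ, 8 * (r + 1 : ℝ≥0∞) ^ (d - 1) * h r := by
  have : NeZero d := ⟨by omega⟩
  rw [← ENNReal.tsum_fiberwise (fun x : Fin d → ℤ => h (supNorm x)) supNorm]
  refine ENNReal.tsum_le_tsum fun r => ?_
  calc ∑' x : (supNorm (d := d)) ⁻¹' {r}, h (supNorm (x : Fin d → ℤ))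
      = ∑' x : (supNorm (d := d)) ⁻¹' {r}, h r :=
        tsum_congr fun x => by rw [show supNorm x.1 = r from x.2]
    _ ≤ ∑' x : (shellCover d r : Set (Fin d → ℤ)), h r :=
        ENNReal.tsum_mono_subtype (fun _ => h r) fun x hx => mem_shellCover hx
    _ = (shellCover d r).card * h r := by
        rw [ENNReal.tsum_const]; simp
    _ ≤ _ := by
        gcongr
        exact_mod_cast card_shellCover_le hd r

end Shells

/-! ### Logarithmic increments against the critical kernel -/

section LogEstimates

open Real

/-- Obtained from `log s ≤ s - 1` at `s = √(1 + t)`. -/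
lemma log_one_add_sq_le_div {t : ℝ} (ht : 0 ≤ t) : log (1 + t) ^ 2 ≤ 4 * t ^ 2 / (1 + t) := by
  set s := √(1 + t) with hs
  have hs2 : s ^ 2 = 1 + t := sq_sqrt (by positivity)
  have hs1 : 1 ≤ s := one_le_sqrt.2 (by linarith)
  have hlog : log (1 + t) ≤ 2 * (s - 1) := by
    rw [← hs2, log_pow]
    have := log_le_sub_one_of_pos (show 0 < s by linarith)
    push_cast; linarith
  have h0 : 0 ≤ log (1 + t) := log_nonneg (by linarith)
  have ht' : t = s ^ 2 - 1 := by linarith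
  rw [show 4 * t ^ 2 / (1 + t) = 4 * t ^ 2 / s ^ 2 by rw [hs2], le_div_iff₀ (by positivity)]
  have : log (1 + t) * s ≤ 2 * t := by
    calc log (1 + t) * s ≤ 2 * (s - 1) * s := by gcongr
      _ ≤ 2 * t := by rw [ht']; nlinarith
  calc log (1 + t) ^ 2 * s ^ 2 = (log (1 + t) * s) ^ 2 := by ring
    _ ≤ (2 * t) ^ 2 := by gcongr
    _ = _ := by ring

/-- Obtained from `log s ≤ s - 1` at the fourth root of `1 + t`. In dimension one this slower growth at
infinity is what makes the sum over long edges converge. -/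
lemma log_one_add_sq_le_div_sqrt {t : ℝ} (ht : 0 ≤ t) :
    log (1 + t) ^ 2 ≤ 16 * t ^ 2 / √(1 + t) ^ 3 := by
  set q := √(1 + t) with hq
  have hq2 : q ^ 2 = 1 + t := sq_sqrt (by positivity)
  have hq1 : 1 ≤ q := one_le_sqrt.2 (by linarith)
  set s := √q with hs
  have hs2 : s ^ 2 = q := sq_sqrt (by positivity)
  have hs1 : 1 ≤ s := one_le_sqrt.2 (by linarith)
  have hlog : log (1 + t) ≤ 4 * (s - 1) := by
    rw [← hq2, ← hs2, ← pow_mul, log_pow]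
    have := log_le_sub_one_of_pos (show 0 < s by linarith)
    push_cast; linarith
  have h0 : 0 ≤ log (1 + t) := log_nonneg (by linarith)
  have ht' : t = s ^ 4 - 1 := by
    have : s ^ 4 = q ^ 2 := by rw [← hs2]; ring
    linarith
  rw [← hs2, le_div_iff₀ (by positivity)]
  have : log (1 + t) * s ^ 3 ≤ 4 * t := by
    calc log (1 + t) * s ^ 3 ≤ 4 * (s - 1) * s ^ 3 := by gcongr
      _ ≤ 4 * t := by
        rw [ht']
        have : 1 ≤ s ^ 3 := one_le_pow₀ hs1
        nlinarith
  calc log (1 + t) ^ 2 * (s ^ 2) ^ 3 = (log (1 + t) * s ^ 3) ^ 2 := by ring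
    _ ≤ (4 * t) ^ 2 := by gcongr
    _ = _ := by ring

lemma inv_sqrt_pow_three_le {p : ℝ} (hp : 0 < p) :
    1 / √(p + 1) ^ 3 ≤ 2 * (1 / √p - 1 / √(p + 1)) := by
  set a := √p with ha
  set b := √(p + 1) with hb
  have ha0 : 0 < a := sqrt_pos.2 hp
  have hb0 : 0 < b := sqrt_pos.2 (by linarith)
  have hab : a ≤ b := sqrt_le_sqrt (by linarith)
  have ha2 : a ^ 2 = p := sq_sqrt hp.le
  have hb2 : b ^ 2 = p + 1 := sq_sqrt (by linarith)
  have h : 1 / a - 1 / b = 1 / (a * b * (a + b)) := by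
    have : (b - a) * (a + b) = 1 := by nlinarith
    rw [div_sub_div _ _ ha0.ne' hb0.ne', div_eq_div_iff (by positivity) (by positivity)]
    linear_combination a * b * this
  rw [h, mul_one_div, div_le_div_iff₀ (by positivity) (by positivity)]
  have : a * b * (a + b) ≤ b * b * (b + b) := by gcongr
  nlinarith

lemma sum_inv_sub_inv_add_le (ρ n : ℕ) :
    ∑ m ∈ Finset.range n, (1 / ((m : ℝ) + 1) - 1 / ((m : ℝ) + 1 + ρ)) ≤
      ∑ m ∈ Finset.range ρ, 1 / ((m : ℝ) + 1) := by
  rw [Finset.sum_sub_distrib, sub_le_iff_le_add]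
  calc ∑ m ∈ Finset.range n, 1 / ((m : ℝ) + 1)
      ≤ ∑ m ∈ Finset.range (ρ + n), 1 / ((m : ℝ) + 1) :=
        Finset.sum_le_sum_of_subset_of_nonneg (Finset.range_mono (by omega))
          fun _ _ _ => by positivity
    _ = _ := by
        rw [Finset.sum_range_add]
        congr 1
        refine Finset.sum_congr rfl fun m _ => ?_
        push_cast
        ring

lemma sum_inv_le_one_add_log (ρ : ℕ) :
    ∑ m ∈ Finset.range ρ, 1 / ((m : ℝ) + 1) ≤ 1 + log ρ := by
  have := harmonic_le_one_add_log ρ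
  simpa [harmonic] using this

/-- The case `d = 1` of `tsum_kernel_mul_log_sq_le`, for partial sums over shells. -/
lemma sum_shell_one_le {ρ : ℕ} (hρ : 0 < ρ) (n : ℕ) :
    ∑ m ∈ Finset.range n, 8 * ((((m : ℝ) + 1) ^ 2)⁻¹ * log (1 + ((m : ℝ) + 1) / ρ) ^ 2) ≤
      256 / (ρ : ℝ) := by
  have hρ' : (0 : ℝ) < ρ := by exact_mod_cast hρ
  have hterm : ∀ m : ℕ, 8 * ((((m : ℝ) + 1) ^ 2)⁻¹ * log (1 + ((m : ℝ) + 1) / ρ) ^ 2) ≤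
      256 / √ρ * (1 / √(ρ + m) - 1 / √(ρ + (m + 1 : ℕ))) := by
    intro m
    have h1 := log_one_add_sq_le_div_sqrt (t := ((m : ℝ) + 1) / ρ) (by positivity)
    have h2 := inv_sqrt_pow_three_le (p := (ρ : ℝ) + m) (by positivity)
    have h3 : √(1 + ((m : ℝ) + 1) / ρ) = √(ρ + m + 1) / √ρ := by
      rw [← sqrt_div (by positivity)]
      congr 1
      field_simp
      ring
    have h4 : √(ρ : ℝ) ^ 2 = ρ := sq_sqrt hρ'.le
    have h5 : 0 < √(ρ : ℝ) := sqrt_pos.2 hρ'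
    calc 8 * ((((m : ℝ) + 1) ^ 2)⁻¹ * log (1 + ((m : ℝ) + 1) / ρ) ^ 2)
        ≤ 8 * ((((m : ℝ) + 1) ^ 2)⁻¹ *
            (16 * (((m : ℝ) + 1) / ρ) ^ 2 / √(1 + ((m : ℝ) + 1) / ρ) ^ 3)) := by gcongr
      _ = 128 / √ρ * (1 / √(ρ + m + 1) ^ 3) := by
        rw [h3, ← h4]
        have : 0 < √((ρ : ℝ) + m + 1) := sqrt_pos.2 (by positivity)
        simp only [sqrt_sq h5.le]
        field_simp
        ring
      _ ≤ 128 / √ρ * (2 * (1 / √(ρ + m) - 1 / √(ρ + m + 1))) := by gcongr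
      _ = _ := by push_cast; rw [← add_assoc]; ring
  calc _ ≤ ∑ m ∈ Finset.range n, 256 / √ρ * (1 / √(ρ + m) - 1 / √((ρ : ℝ) + (m + 1 : ℕ))) :=
        Finset.sum_le_sum fun m _ => hterm m
    _ = 256 / √ρ * (1 / √(ρ + (0 : ℕ)) - 1 / √((ρ : ℝ) + n)) := by
        rw [← Finset.mul_sum, Finset.sum_range_sub' (fun m : ℕ => 1 / √((ρ : ℝ) + m))]
    _ ≤ 256 / √ρ * (1 / √(ρ + (0 : ℕ))) := by
        gcongr
        exact sub_le_self _ (by positivity)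
    _ = 256 / ρ := by
        rw [Nat.cast_zero, add_zero, div_mul_div_comm, mul_one, mul_self_sqrt hρ'.le]

/-- The case `d = 2` of `tsum_kernel_mul_log_sq_le`, for partial sums over shells. -/
lemma sum_shell_two_le {ρ : ℕ} (hρ : 0 < ρ) (n : ℕ) :
    ∑ m ∈ Finset.range n, 8 * ((m : ℝ) + 1 + 1) *
        ((((m : ℝ) + 1) ^ 4)⁻¹ * log (1 + ((m : ℝ) + 1) / ρ) ^ 2) ≤
      64 * (1 + log ρ) / ρ ^ 2 := by
  have hρ' : (0 : ℝ) < ρ := by exact_mod_cast hρ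
  have hterm : ∀ m : ℕ, 8 * ((m : ℝ) + 1 + 1) *
      ((((m : ℝ) + 1) ^ 4)⁻¹ * log (1 + ((m : ℝ) + 1) / ρ) ^ 2) ≤
      64 / ρ ^ 2 * (1 / ((m : ℝ) + 1) - 1 / ((m : ℝ) + 1 + ρ)) := by
    intro m
    have h1 := log_one_add_sq_le_div (t := ((m : ℝ) + 1) / ρ) (by positivity)
    calc 8 * ((m : ℝ) + 1 + 1) * ((((m : ℝ) + 1) ^ 4)⁻¹ * log (1 + ((m : ℝ) + 1) / ρ) ^ 2)
        ≤ 8 * (2 * ((m : ℝ) + 1)) * ((((m : ℝ) + 1) ^ 4)⁻¹ *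
          (4 * (((m : ℝ) + 1) / ρ) ^ 2 / (1 + ((m : ℝ) + 1) / ρ))) := by
          gcongr
          have : (0 : ℝ) ≤ m := by positivity
          linarith
      _ = _ := by field_simp; ring
  calc _ ≤ ∑ m ∈ Finset.range n, 64 / (ρ : ℝ) ^ 2 *
          (1 / ((m : ℝ) + 1) - 1 / ((m : ℝ) + 1 + ρ)) :=
        Finset.sum_le_sum fun m _ => hterm m
    _ ≤ 64 / (ρ : ℝ) ^ 2 * (1 + log ρ) := by
        rw [← Finset.mul_sum]
        gcongr
        exact (sum_inv_sub_inv_add_le ρ n).trans (sum_inv_le_one_add_log ρ)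
    _ = _ := by ring

/-- The kernel `‖u‖^(-2d)` integrated against the square of the logarithmic increment at scale `ρ`.
For `d = 2` each of the `log ρ` dyadic scales below `ρ` contributes equally, and the logarithmic
factor cannot be avoided; for `d = 1` the sum is already of order `1 / ρ`. -/
lemma tsum_kernel_mul_log_sq_le {d : ℕ} (hd : d = 1 ∨ d = 2) {ρ : ℕ} (hρ : 0 < ρ) :
    ∑' u : Fin d → ℤ, ENNReal.ofReal
        (((supNorm u : ℝ) ^ (2 * d))⁻¹ * log (1 + (supNorm u : ℝ) / ρ) ^ 2) ≤
      ENNReal.ofReal (256 * (1 + log ρ) / ρ ^ d) := by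
  have hρ1 : (1 : ℝ) ≤ ρ := by exact_mod_cast hρ
  have hlog : 0 ≤ log (ρ : ℝ) := log_nonneg hρ1
  refine (tsum_comp_supNorm_le hd fun r => ENNReal.ofReal
    (((r : ℝ) ^ (2 * d))⁻¹ * log (1 + (r : ℝ) / ρ) ^ 2)).trans ?_
  refine ENNReal.tsum_le_of_sum_range_le fun n => ?_
  have hreal : ∀ r : ℕ, 8 * (r + 1 : ℝ≥0∞) ^ (d - 1) * ENNReal.ofReal
      (((r : ℝ) ^ (2 * d))⁻¹ * log (1 + (r : ℝ) / ρ) ^ 2) = ENNReal.ofReal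
      (8 * ((r : ℝ) + 1) ^ (d - 1) * (((r : ℝ) ^ (2 * d))⁻¹ * log (1 + (r : ℝ) / ρ) ^ 2)) := by
    intro r
    have h8 : 8 * (r + 1 : ℝ≥0∞) ^ (d - 1) = ENNReal.ofReal (8 * ((r : ℝ) + 1) ^ (d - 1)) := by
      rw [ENNReal.ofReal_mul (by positivity), ENNReal.ofReal_pow (by positivity),
        ENNReal.ofReal_add (by positivity) zero_le_one]
      simp
    rw [h8, ← ENNReal.ofReal_mul (by positivity)]
  simp_rw [hreal]
  rw [← ENNReal.ofReal_sum_of_nonneg fun _ _ => by positivity]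
  refine ENNReal.ofReal_le_ofReal ?_
  cases n with
  | zero => rw [Finset.sum_range_zero]; positivity
  | succ n =>
    rw [Finset.sum_range_succ']
    rcases hd with rfl | rfl
    · have := sum_shell_one_le hρ n
      simp only [Nat.cast_zero, zero_div, add_zero, log_one, Nat.cast_add, Nat.cast_one]
      norm_num
      refine this.trans ?_
      gcongr
      linarith
    · have := sum_shell_two_le hρ n
      simp only [Nat.cast_zero, zero_div, add_zero, log_one, Nat.cast_add, Nat.cast_one]
      norm_num
      refine this.trans ?_
      gcongr
      norm_num

end LogEstimates

/-! ### Iterated-logarithm test functions -/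

section Cutoff

open Real Filter

/-- The iterated logarithm `log (1 + log (n + 1))`, shifted so as to vanish at `0`. -/
def logLog (n : ℕ) : ℝ :=
  log (1 + log ((n : ℝ) + 1))

lemma one_le_one_add_log (n : ℕ) : 1 ≤ 1 + log ((n : ℝ) + 1) := by
  have : 0 ≤ log ((n : ℝ) + 1) := log_nonneg (by have : (0 : ℝ) ≤ n := n.cast_nonneg; linarith)
  linarith

lemma logLog_zero : logLog 0 = 0 := by simp [logLog]

lemma monotone_logLog : Monotone logLog := by
  intro m n h
  have := one_le_one_add_log m
  unfold logLog
  gcongr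

lemma logLog_nonneg (n : ℕ) : 0 ≤ logLog n := log_nonneg (one_le_one_add_log n)

lemma logLog_pos {n : ℕ} (hn : n ≠ 0) : 0 < logLog n := by
  have hn' : (0 : ℝ) < n := by positivity
  have : 0 < log ((n : ℝ) + 1) := log_pos (by linarith)
  exact log_pos (by linarith)

lemma tendsto_logLog : Tendsto logLog atTop atTop := by
  refine tendsto_log_atTop.comp (tendsto_atTop_add_const_left _ _ (tendsto_log_atTop.comp ?_))
  exact tendsto_atTop_add_const_right _ _ tendsto_natCast_atTop_atTop

/-- By concavity, at distance `r` from a point of norm `m` the iterated logarithm has grown by at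
most `log (1 + r / (m + 1))` divided by the logarithm of `m`. -/
lemma logLog_sub_le {m n : ℕ} {r : ℕ} (h : n ≤ m + r) :
    logLog n - logLog m ≤ log (1 + (r : ℝ) / ((m + 1 : ℕ) : ℝ)) / (1 + log ((m : ℝ) + 1)) := by
  have hm := one_le_one_add_log m
  have hn := one_le_one_add_log n
  have hm0 : (0 : ℝ) < (m : ℝ) + 1 := by positivity
  have hn0 : (0 : ℝ) < (n : ℝ) + 1 := by positivity
  have h' : (n : ℝ) ≤ m + r := by exact_mod_cast h
  have hlog : log ((n : ℝ) + 1) ≤ log ((m : ℝ) + 1) + log (1 + (r : ℝ) / ((m : ℝ) + 1)) := by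
    rw [← log_mul hm0.ne' (by positivity)]
    refine log_le_log hn0 ?_
    rw [mul_add, mul_one, mul_div_cancel₀ _ hm0.ne']
    linarith
  rw [logLog, logLog, ← log_div (by linarith) (by linarith)]
  refine (log_le_sub_one_of_pos (by positivity)).trans ?_
  rw [div_sub_one (by linarith)]
  push_cast
  gcongr
  linarith

/-- The terms `1 / (n log n)` are dominated by the increments of the iterated logarithm, so that
their sum telescopes. -/
lemma inv_mul_log_le_logLog_sub (n : ℕ) :
    1 / (((n + 1 : ℕ) : ℝ) + 1) / (1 + log (((n + 1 : ℕ) : ℝ) + 1)) ≤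
      logLog (n + 1) - logLog n := by
  have hm := one_le_one_add_log n
  have hn := one_le_one_add_log (n + 1)
  set x := 1 + log ((n : ℝ) + 1)
  set y := 1 + log (((n + 1 : ℕ) : ℝ) + 1) with hy
  have h1 : 1 - x / y ≤ logLog (n + 1) - logLog n := by
    have h : logLog (n + 1) - logLog n = -log (x / y) := by
      rw [log_div (by linarith) (by linarith)]
      simp only [logLog]
      ring
    have := log_le_sub_one_of_pos (show 0 < x / y by positivity)
    linarith
  refine le_trans ?_ h1
  rw [one_sub_div (by linarith)]
  gcongr
  have hn0 : (0 : ℝ) < (n : ℝ) + 1 := by positivity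
  have h2 : y - x = -log (((n : ℝ) + 1) / (((n + 1 : ℕ) : ℝ) + 1)) := by
    rw [log_div (by positivity) (by positivity)]
    simp only [x, y]
    ring
  have := log_le_sub_one_of_pos
    (show 0 < ((n : ℝ) + 1) / (((n + 1 : ℕ) : ℝ) + 1) by positivity)
  rw [h2]
  refine le_trans (le_of_eq ?_) (neg_le_neg this)
  push_cast
  field_simp
  ring

lemma sum_inv_mul_log_le (R : ℕ) :
    ∑ n ∈ Finset.range R, 1 / ((n : ℝ) + 1) / (1 + log ((n : ℝ) + 1)) ≤ 1 + logLog R := by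
  cases R with
  | zero => simpa using add_nonneg zero_le_one (logLog_nonneg 0)
  | succ R =>
    rw [Finset.sum_range_succ']
    have h : ∑ n ∈ Finset.range R,
        1 / (((n + 1 : ℕ) : ℝ) + 1) / (1 + log (((n + 1 : ℕ) : ℝ) + 1)) ≤ logLog R := by
      refine (Finset.sum_le_sum fun n _ => inv_mul_log_le_logLog_sub n).trans ?_
      rw [Finset.sum_range_sub, logLog_zero, sub_zero]
    have h' := monotone_logLog R.le_succ
    have h0 : 1 / (((0 : ℕ) : ℝ) + 1) / (1 + log (((0 : ℕ) : ℝ) + 1)) = 1 := by simp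
    linarith

/-- The test function: it decreases from `1` at the origin to `0` at distance `R`, linearly in the
iterated logarithm of the distance. -/
def cutoff {d : ℕ} (R : ℕ) (x : Fin d → ℤ) : ℝ :=
  max 0 (1 - logLog (supNorm x) / logLog R)

/-- A bound for the squared increment of `cutoff R` between a point of norm `n` and a point of
larger norm, at distance `r` from it. -/
def incrementBound (R n r : ℕ) : ℝ :=
  if n < R then
    (1 / ((1 + log ((n : ℝ) + 1)) * logLog R)) ^ 2 * log (1 + (r : ℝ) / ((n + 1 : ℕ) : ℝ)) ^ 2
  else 0

lemma incrementBound_nonneg (R n r : ℕ) : 0 ≤ incrementBound R n r := by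
  unfold incrementBound
  split_ifs <;> positivity

lemma cutoff_zero {d : ℕ} (R : ℕ) : cutoff R (0 : Fin d → ℤ) = 1 := by
  simp [cutoff, logLog_zero]

lemma cutoff_eq_zero {d R : ℕ} (hR : R ≠ 0) {x : Fin d → ℤ} (hx : R ≤ supNorm x) :
    cutoff R x = 0 := by
  have h := logLog_pos hR
  have h' := monotone_logLog hx
  refine max_eq_left ?_
  rw [sub_nonpos, le_div_iff₀ h]
  linarith

lemma finite_support_cutoff {d R : ℕ} (hR : R ≠ 0) :
    (Function.support (cutoff R : (Fin d → ℤ) → ℝ)).Finite := by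
  refine (Set.finite_Icc (fun _ => -(R : ℤ)) (fun _ => (R : ℤ))).subset fun x hx => ?_
  have hlt : supNorm x < R := by
    by_contra h
    exact hx (cutoff_eq_zero hR (not_lt.1 h))
  have hi : ∀ i, (x i).natAbs ≤ R := fun i =>
    (Finset.le_sup (f := fun i => (x i).natAbs) (Finset.mem_univ i)).trans hlt.le
  exact ⟨fun i => by have := hi i; change -(R : ℤ) ≤ x i; omega,
    fun i => by have := hi i; change x i ≤ (R : ℤ); omega⟩

lemma cutoff_sub_sq_le_of_le {d R : ℕ} (hR : R ≠ 0) {x y : Fin d → ℤ}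
    (hxy : supNorm x ≤ supNorm y) :
    (cutoff R x - cutoff R y) ^ 2 ≤ incrementBound R (supNorm x) (supNorm (x - y)) := by
  have hpos := logLog_pos hR
  unfold incrementBound
  split_ifs with h
  · have hle : supNorm y ≤ supNorm x + supNorm (x - y) := by
      have := supNorm_add_le x (-(x - y))
      rwa [supNorm_neg, ← sub_eq_add_neg, sub_sub_cancel] at this
    have h1 := logLog_sub_le hle
    have h2 := monotone_logLog hxy
    have h3 : 0 ≤ cutoff R x - cutoff R y := by
      refine sub_nonneg.2 (max_le_max le_rfl ?_)
      gcongr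
    have h4 : cutoff R x - cutoff R y ≤
        (logLog (supNorm y) - logLog (supNorm x)) / logLog R := by
      have hdiv : logLog (supNorm x) / logLog R ≤ logLog (supNorm y) / logLog R := by gcongr
      rw [sub_div]
      unfold cutoff
      rcases max_cases 0 (1 - logLog (supNorm x) / logLog R) with hx | hx <;>
      rcases max_cases 0 (1 - logLog (supNorm y) / logLog R) with hy | hy <;> linarith
    rw [← mul_pow]
    refine pow_le_pow_left₀ h3 (h4.trans ?_) 2
    refine (div_le_div_of_nonneg_right h1 hpos.le).trans (le_of_eq ?_)
    rw [div_div, one_div_mul_eq_div]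
  · rw [cutoff_eq_zero hR (not_lt.1 h), cutoff_eq_zero hR ((not_lt.1 h).trans hxy)]
    simp

lemma cutoff_sub_sq_le {d R : ℕ} (hR : R ≠ 0) (x y : Fin d → ℤ) :
    (cutoff R x - cutoff R y) ^ 2 ≤ incrementBound R (supNorm x) (supNorm (x - y)) +
      incrementBound R (supNorm y) (supNorm (y - x)) := by
  rcases le_total (supNorm x) (supNorm y) with h | h
  · exact (cutoff_sub_sq_le_of_le hR h).trans
      (le_add_of_nonneg_right (incrementBound_nonneg _ _ _))
  · rw [← neg_sq, neg_sub]
    exact (cutoff_sub_sq_le_of_le hR h).trans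
      (le_add_of_nonneg_left (incrementBound_nonneg _ _ _))

/-- The critical long-range kernel `‖x - y‖^(-2d)`, in the supremum norm. On the diagonal it takes
the value `0⁻¹ = 0` if `0 < d`. -/
def criticalKernel {d : ℕ} (x y : Fin d → ℤ) : ℝ≥0∞ :=
  ENNReal.ofReal (((supNorm (x - y) : ℝ) ^ (2 * d))⁻¹)

lemma criticalKernel_comm {d : ℕ} (x y : Fin d → ℤ) :
    criticalKernel x y = criticalKernel y x := by
  rw [criticalKernel, criticalKernel, ← supNorm_neg, neg_sub]

/-- The energy carried by the edges from `x` to points of larger norm. -/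
lemma tsum_criticalKernel_mul_incrementBound_le {d R : ℕ} (hd : d = 1 ∨ d = 2) (x : Fin d → ℤ) :
    ∑' y, criticalKernel x y *
        ENNReal.ofReal (incrementBound R (supNorm x) (supNorm (x - y))) ≤
      if supNorm x < R then ENNReal.ofReal (256 / logLog R ^ 2 *
        (1 / (1 + log ((supNorm x : ℝ) + 1)) / ((supNorm x : ℝ) + 1) ^ d)) else 0 := by
  split_ifs with h
  · set n := supNorm x with hn
    have hL := one_le_one_add_log n
    set b := (1 / ((1 + log ((n : ℝ) + 1)) * logLog R)) ^ 2 with hb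
    have hterm : ∀ y, criticalKernel x y *
        ENNReal.ofReal (incrementBound R n (supNorm (x - y))) = ENNReal.ofReal b *
          ENNReal.ofReal (((supNorm (x - y) : ℝ) ^ (2 * d))⁻¹ *
            log (1 + (supNorm (x - y) : ℝ) / ((n + 1 : ℕ) : ℝ)) ^ 2) := by
      intro y
      rw [criticalKernel, incrementBound, if_pos h, ← ENNReal.ofReal_mul (by positivity),
        ← ENNReal.ofReal_mul (by positivity)]
      congr 1
      ring
    simp_rw [hterm]
    have hshift := (Equiv.subLeft x).tsum_eq fun u : Fin d → ℤ =>
      ENNReal.ofReal (((supNorm u : ℝ) ^ (2 * d))⁻¹ *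
        log (1 + (supNorm u : ℝ) / ((n + 1 : ℕ) : ℝ)) ^ 2)
    simp only [Equiv.subLeft_apply] at hshift
    rw [ENNReal.tsum_mul_left, hshift]
    refine (mul_le_mul_right (tsum_kernel_mul_log_sq_le hd n.succ_pos) _).trans (le_of_eq ?_)
    rw [← ENNReal.ofReal_mul (by positivity)]
    congr 1
    rw [hb]
    push_cast
    have : 1 + log ((n : ℝ) + 1) ≠ 0 := by linarith
    rcases eq_or_ne (logLog R) 0 with h0 | h0
    · simp [h0]
    · field_simp
  · simp [incrementBound, h]

/-- The critical kernel is recurrent in dimensions one and two: the energy of the test functions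
tends to zero. -/
lemma energy_criticalKernel_cutoff_le {d R : ℕ} (hd : d = 1 ∨ d = 2) (hR : R ≠ 0) :
    WeightedWalk.energy criticalKernel (cutoff R : (Fin d → ℤ) → ℝ) ≤
      ENNReal.ofReal (4096 * (1 + logLog R) / logLog R ^ 2) := by
  have hpos := logLog_pos hR
  set S : ℝ≥0∞ := ∑' x : Fin d → ℤ, ∑' y, criticalKernel x y *
        ENNReal.ofReal (incrementBound R (supNorm x) (supNorm (x - y))) with hS
  have h1 : WeightedWalk.energy criticalKernel (cutoff R : (Fin d → ℤ) → ℝ) ≤ S + S := by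
    calc WeightedWalk.energy criticalKernel (cutoff R : (Fin d → ℤ) → ℝ)
        ≤ ∑' x : Fin d → ℤ, ∑' y, (criticalKernel x y *
            ENNReal.ofReal (incrementBound R (supNorm x) (supNorm (x - y))) +
            criticalKernel y x *
              ENNReal.ofReal (incrementBound R (supNorm y) (supNorm (y - x)))) := by
          refine ENNReal.tsum_le_tsum fun x => ENNReal.tsum_le_tsum fun y => ?_
          rw [criticalKernel_comm y x, ← mul_add, ← ENNReal.ofReal_add
            (incrementBound_nonneg _ _ _) (incrementBound_nonneg _ _ _)]
          exact mul_le_mul_right (ENNReal.ofReal_le_ofReal (cutoff_sub_sq_le hR x y)) _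
      _ = S + S := by
          simp_rw [ENNReal.tsum_add]
          congr 1
          rw [ENNReal.tsum_comm]
  have h2 : S ≤ ENNReal.ofReal (2048 * (1 + logLog R) / logLog R ^ 2) := by
    calc S ≤ ∑' x : Fin d → ℤ, if supNorm x < R then ENNReal.ofReal (256 / logLog R ^ 2 *
            (1 / (1 + log ((supNorm x : ℝ) + 1)) / ((supNorm x : ℝ) + 1) ^ d)) else 0 :=
          ENNReal.tsum_le_tsum fun x => tsum_criticalKernel_mul_incrementBound_le hd x
      _ ≤ ∑' n : ℕ, 8 * (n + 1 : ℝ≥0∞) ^ (d - 1) * if n < R then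
            ENNReal.ofReal (256 / logLog R ^ 2 *
              (1 / (1 + log ((n : ℝ) + 1)) / ((n : ℝ) + 1) ^ d)) else 0 :=
          tsum_comp_supNorm_le hd fun n => if n < R then ENNReal.ofReal (256 / logLog R ^ 2 *
            (1 / (1 + log ((n : ℝ) + 1)) / ((n : ℝ) + 1) ^ d)) else 0
      _ = ∑ n ∈ Finset.range R, ENNReal.ofReal (2048 / logLog R ^ 2 *
            (1 / ((n : ℝ) + 1) / (1 + log ((n : ℝ) + 1)))) := by
          rw [tsum_eq_sum (s := Finset.range R)]
          · refine Finset.sum_congr rfl fun n hn => ?_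
            have hL := one_le_one_add_log n
            rw [if_pos (Finset.mem_range.1 hn)]
            have h8 : 8 * (n + 1 : ℝ≥0∞) ^ (d - 1) =
                ENNReal.ofReal (8 * ((n : ℝ) + 1) ^ (d - 1)) := by
              rw [ENNReal.ofReal_mul (by positivity), ENNReal.ofReal_pow (by positivity),
                ENNReal.ofReal_add (by positivity) zero_le_one]
              simp
            rw [h8, ← ENNReal.ofReal_mul (by positivity)]
            congr 1
            have hpow : ((n : ℝ) + 1) ^ d = ((n : ℝ) + 1) ^ (d - 1) * ((n : ℝ) + 1) := by
              rw [← pow_succ]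
              congr 1
              omega
            rw [hpow]
            field_simp
            norm_num
          · intro n hn
            rw [if_neg (by simpa using hn), mul_zero]
      _ = ENNReal.ofReal (2048 / logLog R ^ 2 * ∑ n ∈ Finset.range R,
            (1 / ((n : ℝ) + 1) / (1 + log ((n : ℝ) + 1)))) := by
          rw [Finset.mul_sum, ENNReal.ofReal_sum_of_nonneg]
          intro n _
          have hL := one_le_one_add_log n
          positivity
      _ ≤ ENNReal.ofReal (2048 / logLog R ^ 2 * (1 + logLog R)) := by
          gcongr
          exact sum_inv_mul_log_le R
      _ = _ := by congr 1; ring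
  refine h1.trans ((add_le_add h2 h2).trans (le_of_eq ?_))
  have := logLog_nonneg R
  rw [← ENNReal.ofReal_add (by positivity) (by positivity)]
  congr 1
  ring

lemma tendsto_energy_criticalKernel_cutoff {d : ℕ} (hd : d = 1 ∨ d = 2) :
    Tendsto (fun R : ℕ =>
      WeightedWalk.energy criticalKernel (cutoff (R + 1) : (Fin d → ℤ) → ℝ)) atTop (nhds 0) := by
  have hinv : Tendsto (fun R : ℕ => (logLog (R + 1))⁻¹) atTop (nhds 0) :=
    tendsto_inv_atTop_zero.comp (tendsto_logLog.comp (tendsto_add_atTop_nat 1))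
  have hreal : Tendsto (fun R : ℕ => 4096 * (1 + logLog (R + 1)) / logLog (R + 1) ^ 2) atTop
      (nhds 0) := by
    have h := ((hinv.pow 2).add hinv).const_mul 4096
    norm_num at h
    refine h.congr fun R => ?_
    have := logLog_pos R.succ_ne_zero
    field_simp
  have h := ENNReal.tendsto_ofReal hreal
  rw [ENNReal.ofReal_zero] at h
  exact tendsto_of_tendsto_of_tendsto_of_le_of_le tendsto_const_nhds h (fun _ => zero_le)
    fun R => energy_criticalKernel_cutoff_le hd R.succ_ne_zero

lemma energy_criticalKernel_translate {d : ℕ} (a : Fin d → ℤ) (f : (Fin d → ℤ) → ℝ) :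
    WeightedWalk.energy criticalKernel (fun x => f (x - a)) =
      WeightedWalk.energy criticalKernel f := by
  unfold WeightedWalk.energy
  rw [← (Equiv.addRight a).tsum_eq]
  refine tsum_congr fun x => ?_
  rw [← (Equiv.addRight a).tsum_eq]
  refine tsum_congr fun y => ?_
  simp [criticalKernel]

/-- The sum is compared with `tsum_kernel_mul_log_sq_le` at scale `1`, where the squared logarithm is
at least `log 2 ^ 2` off the origin. -/
lemma tsum_criticalKernel_ne_top {d : ℕ} (hd : d = 1 ∨ d = 2) (x : Fin d → ℤ) :
    ∑' y, (if x = y then 0 else criticalKernel x y) ≠ ∞ := by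
  have hl : 0 < log 2 := log_pos one_lt_two
  have key := tsum_kernel_mul_log_sq_le hd one_pos
  have hle : ∑' y, ENNReal.ofReal (log 2 ^ 2) * (if x = y then 0 else criticalKernel x y) ≤
      ∑' u : Fin d → ℤ, ENNReal.ofReal
        (((supNorm u : ℝ) ^ (2 * d))⁻¹ * log (1 + (supNorm u : ℝ) / (1 : ℕ)) ^ 2) := by
    rw [← (Equiv.subLeft x).tsum_eq]
    refine ENNReal.tsum_le_tsum fun y => ?_
    split_ifs with h
    · simp
    · rw [criticalKernel, ← ENNReal.ofReal_mul (by positivity)]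
      refine ENNReal.ofReal_le_ofReal ?_
      have hne : supNorm (x - (Equiv.subLeft x) y) ≠ 0 := fun h0 =>
        h (sub_eq_zero.1 (supNorm_eq_zero.1 h0))
      rw [Equiv.subLeft_apply, sub_sub_cancel] at hne ⊢
      have hone : (1 : ℝ) ≤ supNorm y := by exact_mod_cast Nat.one_le_iff_ne_zero.2 hne
      rw [mul_comm, Nat.cast_one, div_one]
      gcongr
      linarith
  rw [ENNReal.tsum_mul_left] at hle
  intro htop
  rw [htop, ENNReal.mul_top (by positivity)] at hle
  exact ENNReal.ofReal_ne_top (top_le_iff.1 (hle.trans key))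

end Cutoff

/-! ### Random weights -/

section RandomWeights

lemma ofReal_mul_latticeNorm_rpow_le {d : ℕ} (C : ℝ≥0) {x y : Fin d → ℤ} (hxy : x ≠ y) :
    ENNReal.ofReal ((C : ℝ) * latticeNorm (x - y) ^ (-(2 * (d : ℝ)))) ≤
      C * criticalKernel x y := by
  have hpos : (0 : ℝ) < supNorm (x - y) := by
    exact_mod_cast Nat.pos_of_ne_zero fun h => hxy (sub_eq_zero.1 (supNorm_eq_zero.1 h))
  have hle := supNorm_le_latticeNorm (x - y)
  rw [ENNReal.ofReal_mul C.coe_nonneg, ENNReal.ofReal_coe_nnreal, criticalKernel]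
  gcongr
  rw [Real.rpow_neg (hpos.le.trans hle)]
  have : (2 * (d : ℝ)) = ((2 * d : ℕ) : ℝ) := by push_cast; ring
  rw [this, Real.rpow_natCast]
  gcongr

variable {V Ω : Type*} {mΩ : MeasurableSpace Ω} {P : Measure Ω}

lemma measurable_conductance {G : SimpleGraph V} {ω : G.edgeSet → Ω → ℝ≥0}
    (hω : ∀ e, Measurable (ω e)) (x y : V) :
    Measurable fun ξ => WeightedWalk.conductance G (fun e => ω e ξ) x y := by
  unfold WeightedWalk.conductance
  split_ifs with h
  · exact (hω _).coe_nnreal_ennreal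
  · exact measurable_const

lemma lintegral_energy [Countable V] {G : SimpleGraph V} {ω : G.edgeSet → Ω → ℝ≥0}
    (hω : ∀ e, Measurable (ω e)) (f : V → ℝ) :
    ∫⁻ ξ, WeightedWalk.energy (WeightedWalk.conductance G fun e => ω e ξ) f ∂P =
      WeightedWalk.energy
        (fun x y => ∫⁻ ξ, WeightedWalk.conductance G (fun e => ω e ξ) x y ∂P) f := by
  have hm := measurable_conductance hω
  unfold WeightedWalk.energy
  rw [lintegral_tsum fun x => (Measurable.tsum fun y => (hm x y).mul_const _).aemeasurable]
  refine tsum_congr fun x => ?_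
  rw [lintegral_tsum fun y => ((hm x y).mul_const _).aemeasurable]
  exact tsum_congr fun y => lintegral_mul_const _ (hm x y)

lemma measurable_energy [Countable V] {G : SimpleGraph V} {ω : G.edgeSet → Ω → ℝ≥0}
    (hω : ∀ e, Measurable (ω e)) (f : V → ℝ) :
    Measurable fun ξ => WeightedWalk.energy (WeightedWalk.conductance G fun e => ω e ξ) f := by
  unfold WeightedWalk.energy
  exact Measurable.tsum fun x => Measurable.tsum fun y =>
    (measurable_conductance hω x y).mul_const _

/-- If the expected energies of a sequence of functions tend to zero, then by Fatou's lemma almost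
every realization gives some function of the sequence an arbitrarily small energy. -/
lemma ae_exists_energy_le [Countable V] {G : SimpleGraph V} {ω : G.edgeSet → Ω → ℝ≥0}
    (hω : ∀ e, Measurable (ω e)) (f : ℕ → V → ℝ)
    (h : Filter.Tendsto (fun n => ∫⁻ ξ,
      WeightedWalk.energy (WeightedWalk.conductance G fun e => ω e ξ) (f n) ∂P)
      Filter.atTop (nhds 0)) :
    ∀ᵐ ξ ∂P, ∀ ε : ℝ≥0∞, 0 < ε → ∃ n,
      WeightedWalk.energy (WeightedWalk.conductance G fun e => ω e ξ) (f n) ≤ ε := by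
  have hm := fun n => measurable_energy hω (f n)
  have h0 := lintegral_liminf_le (μ := P) (u := Filter.atTop) hm
  rw [h.liminf_eq, nonpos_iff_eq_zero, lintegral_eq_zero_iff (Measurable.liminf hm)] at h0
  filter_upwards [h0] with ξ hξ ε hε
  have hlt : Filter.liminf (fun n =>
      WeightedWalk.energy (WeightedWalk.conductance G fun e => ω e ξ) (f n)) Filter.atTop < ε := by
    rw [hξ]
    exact hε
  obtain ⟨n, hn⟩ := (Filter.frequently_lt_of_liminf_lt (by isBoundedDefault) hlt).exists
  exact ⟨n, hn.le⟩

end RandomWeights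

end

theorem mainTheorem5 (d : ℕ) (hd : d = 1 ∨ d = 2)
    {Ω : Type*} [MeasurableSpace Ω] (P : Measure Ω) [IsProbabilityMeasure P]
    (ω : (⊤ : SimpleGraph (Fin d → ℤ)).edgeSet → Ω → ℝ≥0) (hω : ∀ e, Measurable (ω e))
    (C : ℝ≥0)
    (hC : ∀ (x y : Fin d → ℤ) (h : (⊤ : SimpleGraph (Fin d → ℤ)).Adj x y),
      ∫⁻ ξ, (ω ⟨s(x, y), h⟩ ξ : ℝ≥0∞) ∂P ≤
        ENNReal.ofReal ((C : ℝ) * latticeNorm (x - y) ^ (-(2 * (d : ℝ))))) :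
    ∀ᵐ ξ ∂P,
      (∀ x, WeightedWalk.totalConductance ⊤ (fun e => ω e ξ) x < ∞) ∧
        WeightedWalk.IsRecurrent ⊤ (fun e => ω e ξ) := by
  have hmean : ∀ x y : Fin d → ℤ,
      ∫⁻ ξ, WeightedWalk.conductance ⊤ (fun e => ω e ξ) x y ∂P ≤
        C * (if x = y then 0 else criticalKernel x y) := by
    intro x y
    by_cases hxy : x = y
    · simp [WeightedWalk.conductance, hxy]
    · have hadj : (⊤ : SimpleGraph (Fin d → ℤ)).Adj x y := hxy
      simp only [WeightedWalk.conductance, dif_pos hadj, if_neg hxy]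
      exact (hC x y hadj).trans (ofReal_mul_latticeNorm_rpow_le C hxy)
  have htotal : ∀ᵐ ξ ∂P, ∀ x, WeightedWalk.totalConductance ⊤ (fun e => ω e ξ) x < ∞ := by
    refine ae_all_iff.2 fun x => ?_
    have hm := measurable_conductance hω x
    refine ae_lt_top (Measurable.tsum hm) (ne_top_of_le_ne_top
      (ENNReal.mul_ne_top (ENNReal.coe_ne_top (r := C)) (tsum_criticalKernel_ne_top hd x)) ?_)
    unfold WeightedWalk.totalConductance
    rw [lintegral_tsum fun y => (hm y).aemeasurable, ← ENNReal.tsum_mul_left]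
    exact ENNReal.tsum_le_tsum fun y => hmean x y
  have henergy : ∀ᵐ ξ ∂P, ∀ (a : Fin d → ℤ) (ε : ℝ≥0∞), 0 < ε → ∃ R : ℕ,
      WeightedWalk.energy (WeightedWalk.conductance ⊤ fun e => ω e ξ)
        (fun x => cutoff (R + 1) (x - a)) ≤ ε := by
    refine ae_all_iff.2 fun a => ae_exists_energy_le hω _ ?_
    have hlim := ENNReal.Tendsto.const_mul (tendsto_energy_criticalKernel_cutoff hd)
      (Or.inr (ENNReal.coe_ne_top (r := C)))
    rw [mul_zero] at hlim
    refine tendsto_of_tendsto_of_tendsto_of_le_of_le tendsto_const_nhds hlim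
      (fun _ => zero_le) fun R => ?_
    dsimp only
    rw [lintegral_energy hω, ← energy_criticalKernel_translate a]
    unfold WeightedWalk.energy
    simp_rw [← ENNReal.tsum_mul_left, ← mul_assoc]
    refine ENNReal.tsum_le_tsum fun x => ENNReal.tsum_le_tsum fun y => ?_
    refine mul_le_mul_left ((hmean x y).trans (mul_le_mul_right ?_ _)) _
    split_ifs
    · exact zero_le
    · exact le_rfl
  filter_upwards [htotal, henergy] with ξ hξ hE
  refine ⟨hξ, fun a => ?_⟩
  refine WeightedWalk.frequently_eq_of_energy_le ⊤ _ (fun x => (hξ x).ne) a fun ε hε => ?_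
  obtain ⟨R, hR⟩ := hE a ε hε
  refine ⟨_, ?_, ?_, hR⟩
  · refine ((finite_support_cutoff R.succ_ne_zero).image (· + a)).subset fun x hx => ?_
    exact ⟨x - a, hx, sub_add_cancel x a⟩
  · simp [cutoff_zero]
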